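/- **Setting.** Let $\sigma_e>0$, $r=p=2$, $q=1$. For every $n>2$ let $x_{n,1},\dots,x_{n,n}$ be real constants, let $X_n\in\mathbb R^{n\times 2}$ have $i$-th row $(1,x_{n,i})$, and let $Y_n=(y_1,\dots,y_n)^T\sim\mathcal N(X_n\beta_n,\sigma_e^2 I_n)$, where $\beta_n=(\beta_{2,n},\beta_{1,n})^T$ (intercept, slope) and $\beta_n\to\beta=(\beta_2,\beta_1)^T\in\mathbb R^2$. (A fixed coefficient vector is the case $\beta_n=\beta$ for all $n$.) The null hypothesis is $\beta_1=0$. Let $\Delta_n>0$ be clipping bounds and $\rho_n>0$ privacy parameters. **DP statistics.** Write $[t]_a^b$ for $t$ truncated to $[a,b]$ and put $\rho'=\rho_n/5$. With independent Gaussian variables $N_1,\dots,N_5$, independent of $Y_n$, where $N_1,N_2\sim\mathcal N(0,\tfrac{2\Delta_n^2}{\rho' n^2})$, $N_3,N_5\sim\mathcal N(0,\tfrac{\Delta_n^4}{2\rho' n^2})$, $N_4\sim\mathcal N(0,\tfrac{2\Delta_n^4}{\rho' n^2})$, let $$\tilde{\bar x}=\tfrac1n\sum_i[x_{n,i}]_{-\Delta_n}^{\Delta_n}+N_1,\quad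 \tilde{\bar y}=\tfrac1n\sum_i[y_i]_{-\Delta_n}^{\Delta_n}+N_2,\quad \widetilde{\overline{x^2}}=\tfrac1n\sum_i[x_{n,i}^2]_0^{\Delta_n^2}+N_3,$$ $$\widetilde{\overline{xy}}=\tfrac1n\sum_i[x_{n,i}y_i]_{-\Delta_n^2}^{\Delta_n^2}+N_4,\quad \widetilde{\overline{y^2}}=\tfrac1n\sum_i[y_i^2]_0^{\Delta_n^2}+N_5,$$ $$\tilde\beta_1=\frac{\widetilde{\overline{xy}}-\tilde{\bar x}\tilde{\bar y}}{\widetilde{\overline{x^2}}-\tilde{\bar x}^2},\qquad \tilde\beta_2=\frac{\tilde{\bar y}\,\widetilde{\overline{x^2}}-\tilde{\bar x}\,\widetilde{\overline{xy}}}{\widetilde{\overline{x^2}}-\tilde{\bar x}^2},$$ $$\widetilde{S_0^2}=\frac{n\widetilde{\overline{y^2}}-2\tilde\beta_2 n\tilde{\bar y}+n\tilde\beta_2^2}{n-r},$$ $$\widetilde{S^2}=\frac{n\widetilde{\overline{y^2}}-2\tilde\beta_2 n\tilde{\bar y}-2\tilde\beta_1 n\widetilde{\overline{xy}}+n\tilde\beta_2^2+2\tilde\beta_1\tilde\beta_2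 n\tilde{\bar x}+\tilde\beta_1^2 n\widetilde{\overline{x^2}}}{n-r}.$$ The DP least-squares estimates under the alternative and the null are $\tilde\beta_n=(\tilde\beta_2,\tilde\beta_1)^T$ and $\tilde\beta_n^N=(\tilde{\bar y},0)^T$. The procedure returns $\perp$ unless $\min\bigl(\widetilde{S_0^2},\,n(\widetilde{\overline{x^2}}-\tilde{\bar x}^2)/(n-1)\bigr)>0$. The DP $F$-statistic $\tilde T_n$ is a real random variable which, whenever the procedure does not return $\perp$, equals $$\tilde T_n=\frac1{r-q}\cdot\frac{(\tilde\beta_n-\tilde\beta_n^N)^T\,\widetilde{X^TX}\,(\tilde\beta_n-\tilde\beta_n^N)}{\widetilde{S^2}},\qquad \widetilde{X^TX}=n\begin{pmatrix}1&\tilde{\bar x}\\ \tilde{\bar x}&\widetilde{\overline{x^2}}\end{pmatrix};$$ its value when $\perp$ is returned is arbitrary. **Assumptions.** 1. $\frac1n\sum_i x_{n,i}\to c_x$ and $\frac1n\sum_i x_{n,i}^2\to c_{x^2}$ for some real $c_x,c_{x^2}$ with $c_{x^2}>c_x^2$. 2. $\Delta_n^2/(\rho_n n)\to0$ and $\Delta_n^4/(\rho_n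 n)\to0$. 3. $\mathbb P[\exists i\le n:\ y_i\notin[-\Delta_n,\Delta_n]]\to0$, and $x_{n,i}\in[-\Delta_n,\Delta_n]$ for all $n>2$ and $i\le n$. **Theorem.** As $n\to\infty$: 1. Under the null hypothesis ($\beta_1=0$), $\tilde\beta_n^N\to\beta$ in probability. 2. Under the alternative (in fact for every value of $\beta_1$), $\tilde\beta_n\to\beta$ in probability. 3. Let $\eta_n^2=\|X_n\beta_n-X_n\beta_n^N\|^2/\sigma_e^2$, where $\beta_n^N=\mathbb E[(\bar y,0)^T]$ is the expected non-private least-squares estimate under the constraint of zero slope. If $\eta_n^2\to\eta^2$ for some $\eta\in\mathbb R$, then $\tilde T_n$ converges in distribution to $\chi^2_{r-q}(\eta^2)/(r-q)$, where $\chi^2_K(\lambda)$ is the law of $\|Z\|^2$ for $Z\sim\mathcal N(v,I_K)$ with $\|v\|^2=\lambda$. -/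

import Mathlib

open MeasureTheory ProbabilityTheory Filter Topology

noncomputable section

namespace DPRegression

/-- The design matrix of simple linear regression: first column all ones, second column `x`.
Coefficient vectors are `![intercept, slope]`. -/
def designMatrix {n : ℕ} (x : Fin n → ℝ) : Matrix (Fin n) (Fin 2) ℝ :=
  Matrix.of fun i => ![1, x i]

/-- The law `N(X β, σ² I)` of the response vector. -/
def responseLaw {n : ℕ} (x : Fin n → ℝ) (β : Fin 2 → ℝ) (σ : ℝ) : Measure (Fin n → ℝ) :=
  Measure.pi fun i => gaussianReal ((designMatrix x).mulVec β i) (σ ^ 2).toNNReal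

/-- The empirical mean `(1/n) ∑ v i`. -/
def mean {n : ℕ} (v : Fin n → ℝ) : ℝ := (∑ i, v i) / n

/-- Truncation of `t` to the interval `[a, b]`. -/
def clip (a b t : ℝ) : ℝ := max a (min b t)

/-- The five (exact or privatized) first and second moments
`x̄, ȳ, mean of x², mean of xy, mean of y²`. -/
structure Moments where
  xbar : ℝ
  ybar : ℝ
  xx : ℝ
  xy : ℝ
  yy : ℝ

namespace Moments

/-- The slope `β₁` computed from the moments. -/
def slope (s : Moments) : ℝ := (s.xy - s.xbar * s.ybar) / (s.xx - s.xbar ^ 2)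

/-- The intercept `β₂` computed from the moments. -/
def intercept (s : Moments) : ℝ :=
  (s.ybar * s.xx - s.xbar * s.xy) / (s.xx - s.xbar ^ 2)

/-- The least squares coefficients under the alternative (no constraint on `β`). -/
def betaAlt (s : Moments) : Fin 2 → ℝ := ![s.intercept, s.slope]

/-- The least squares coefficients under the null hypothesis (slope equal to `0`). -/
def betaNull (s : Moments) : Fin 2 → ℝ := ![s.ybar, 0]

/-- The Gram matrix `Xᵀ X` expressed through the moments. -/
def gram (n : ℕ) (s : Moments) : Matrix (Fin 2) (Fin 2) ℝ :=
  !![(n : ℝ), n * s.xbar; n * s.xbar, n * s.xx]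

/-- The residual variance estimate under the null hypothesis, as the procedure computes it. -/
def nullVar (n r : ℕ) (s : Moments) : ℝ :=
  (n * s.yy - 2 * s.intercept * n * s.ybar + n * s.intercept ^ 2) / ((n : ℝ) - r)

/-- The residual variance estimate `S² = ‖Y - X β‖² / (n - r)`, expanded in the moments. -/
def residVar (n r : ℕ) (s : Moments) : ℝ :=
  (n * s.yy - 2 * s.intercept * n * s.ybar - 2 * s.slope * n * s.xy + n * s.intercept ^ 2
    + 2 * s.slope * s.intercept * n * s.xbar + s.slope ^ 2 * n * s.xx) / ((n : ℝ) - r)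

/-- The statistic `(1 / (r - q)) ‖X β - X β^N‖² / S²`, where
`‖X d‖² = dᵀ (Xᵀ X) d` is computed from the moments. -/
def fStat (n r q : ℕ) (s : Moments) : ℝ :=
  1 / ((r : ℝ) - q) *
    (((s.betaAlt - s.betaNull) ⬝ᵥ (s.gram n).mulVec (s.betaAlt - s.betaNull)) / s.residVar n r)

/-- The procedure returns its statistics (rather than `⊥`) exactly in this case. -/
def Succeeds (n r : ℕ) (s : Moments) : Prop :=
  0 < min (s.nullVar n r) ((n * s.xx - n * s.xbar ^ 2) / ((n : ℝ) - 1))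

/-- On success the statistic is the familiar closed form `β₁² n (mean of x² - x̄²) / S²`. -/
theorem fStat_eq_of_succeeds {n : ℕ} {s : Moments} (hs : s.Succeeds n 2) :
    s.fStat n 2 1 = s.slope ^ 2 * n * (s.xx - s.xbar ^ 2) / s.residVar n 2 := by
  have hv : s.xx - s.xbar ^ 2 ≠ 0 := by
    intro h
    have h2 := (lt_min_iff.mp hs).2
    rw [← mul_sub, h] at h2
    simp at h2
  have hi : s.intercept = s.ybar - s.slope * s.xbar := by
    unfold intercept slope
    field_simp
    ring
  unfold fStat betaAlt betaNull gram
  simp [dotProduct, Matrix.mulVec, Fin.sum_univ_two, hi]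
  ring

end Moments

/-- The exact sample moments of a data set. -/
def sampleMoments {n : ℕ} (x y : Fin n → ℝ) : Moments where
  xbar := mean x
  ybar := mean y
  xx := mean fun i => x i ^ 2
  xy := mean fun i => x i * y i
  yy := mean fun i => y i ^ 2

/-- The moments released by the private procedure: each data point's contribution is truncated,
and the noise `z k` is added to the `k`-th average. -/
def privateMoments {n : ℕ} (Δ : ℝ) (x y : Fin n → ℝ) (z : Fin 5 → ℝ) : Moments where
  xbar := (mean fun i => clip (-Δ) Δ (x i)) + z 0
  ybar := (mean fun i => clip (-Δ) Δ (y i)) + z 1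
  xx := (mean fun i => clip 0 (Δ ^ 2) (x i ^ 2)) + z 2
  xy := (mean fun i => clip (-Δ ^ 2) (Δ ^ 2) (x i * y i)) + z 3
  yy := (mean fun i => clip 0 (Δ ^ 2) (y i ^ 2)) + z 4

/-- The variances of the five noise variables, when each release gets the budget `ρ`. -/
def noiseVariance (n : ℕ) (Δ ρ : ℝ) : Fin 5 → ℝ :=
  ![2 * Δ ^ 2 / (ρ * n ^ 2), 2 * Δ ^ 2 / (ρ * n ^ 2), Δ ^ 4 / (2 * ρ * n ^ 2),
    2 * Δ ^ 4 / (ρ * n ^ 2), Δ ^ 4 / (2 * ρ * n ^ 2)]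

/-- The law of the noise of the procedure with total budget `ρ`, split equally among the five
releases: independent centred Gaussians. -/
def noiseLaw (n : ℕ) (Δ ρ : ℝ) : Measure (Fin 5 → ℝ) :=
  Measure.pi fun k => gaussianReal 0 (noiseVariance n Δ (ρ / 5) k).toNNReal

/-- The coefficients under the null hypothesis minimize `‖Y - X z‖²` over `z` with zero slope. -/
theorem betaNull_isLeastSquares {n : ℕ} (x y : Fin n → ℝ) (z : Fin 2 → ℝ) (hz : z 1 = 0) :
    ∑ i, (y i - (designMatrix x).mulVec (sampleMoments x y).betaNull i) ^ 2
      ≤ ∑ i, (y i - (designMatrix x).mulVec z i) ^ 2 := by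
  rcases Nat.eq_zero_or_pos n with rfl | hn
  · simp
  have hn' : (n : ℝ) ≠ 0 := by positivity
  have hm : ∑ i, y i = n * mean y := by unfold mean; field_simp
  have key : ∀ c : ℝ, ∑ i, (y i - c) ^ 2 = ∑ i, (y i - mean y) ^ 2 + n * (mean y - c) ^ 2 := by
    intro c
    have : ∀ i, (y i - c) ^ 2
        = (y i - mean y) ^ 2 + (2 * (mean y - c) * y i + (c ^ 2 - mean y ^ 2)) := by
      intro i; ring
    simp only [this, Finset.sum_add_distrib, ← Finset.mul_sum, hm, Finset.sum_const,
      Finset.card_univ, Fintype.card_fin, nsmul_eq_mul]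
    ring
  have h1 : ∀ i, (designMatrix x).mulVec (sampleMoments x y).betaNull i = mean y := by
    intro i
    simp [designMatrix, Matrix.mulVec, dotProduct, Fin.sum_univ_two, Moments.betaNull,
      sampleMoments]
  have h2 : ∀ i, (designMatrix x).mulVec z i = z 0 := by
    intro i
    simp [designMatrix, Matrix.mulVec, dotProduct, Fin.sum_univ_two, hz]
  simp only [h1, h2]
  rw [key (z 0)]
  have : 0 ≤ (n : ℝ) * (mean y - z 0) ^ 2 := by positivity
  linarith

/-- `β^N = E[β̂^N]`: the expectation of the non-private null least squares estimate when
`Y ∼ N(X β, σ² I)`. -/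
def expectedNull {n : ℕ} (x : Fin n → ℝ) (β : Fin 2 → ℝ) (σ : ℝ) : Fin 2 → ℝ :=
  fun j => ∫ y, (sampleMoments x y).betaNull j ∂(responseLaw x β σ)

/-- `η² = ‖X β - X β^N‖² / σ²`. -/
def noncentrality {n : ℕ} (x : Fin n → ℝ) (β : Fin 2 → ℝ) (σ : ℝ) : ℝ :=
  (∑ i, ((designMatrix x).mulVec β i - (designMatrix x).mulVec (expectedNull x β σ) i) ^ 2)
    / σ ^ 2

/-- The noncentral chi-squared law with `K` degrees of freedom and noncentrality `l ≥ 0`: the law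
of `‖Z‖²` for `Z ∼ N(v, I_K)` with `‖v‖² = l`. By rotation invariance it does not depend on the
choice of `v`; here all coordinates of `v` are equal. -/
def noncentralChiSq (K : ℕ) (l : ℝ) : Measure ℝ :=
  (Measure.pi fun _ : Fin K => gaussianReal (√(l / K)) 1).map fun z => ∑ k, z k ^ 2

instance (K : ℕ) (l : ℝ) : IsProbabilityMeasure (noncentralChiSq K l) :=
  Measure.isProbabilityMeasure_map
    (Finset.measurable_sum _ fun k _ => (measurable_pi_apply k).pow_const 2).aemeasurable

end DPRegression

end

/-! The clipping assumption makes truncation inactive with probability tending to one, so the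
private moments may be replaced by `noisyMoments`: the exact sample moments plus Gaussian noise. The
assumptions on `Δ` and `ρ` say that this noise has standard deviation o(n^(-1/2)), so it vanishes
even after multiplication by √n (`tendstoInMeasure_sqrt_mul_noise`).

Consistency: the moments are polynomials in the design moments, the coefficients, averages of the
standardised errors and the noise. By Chebyshev those averages vanish, so the moments converge in
probability to `limitMoments` (`tendstoInMeasure_noisyMoments`). Slope and intercept are continuous
there because `cx ^ 2 < cxx`, and their values at the limit are the true coefficients.

Limit law: write v for the empirical variance of the design. On success the statistic is the square
of √n times the noisy covariance of x and y, divided by the noisy design variance times the residual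
variance. By `sqrt_mul_crossMoment` the scaled covariance is σ√v (δ + G) + B, where δ² is the
noncentrality, G is exactly standard Gaussian for each large n, and B collects noise and vanishes.
The denominator tends to (cxx - cx²)σ², so Slutsky's theorem gives the limit (|η| + G)²
(`tendstoInDistribution_sq_perturbed`). Failure of the procedure has vanishing probability, since
success holds on a neighbourhood of the limiting moments (`eventually_succeeds`), so the value
assigned on failure does not matter. -/

namespace DPRegression

/-! ### Convergence in probability to a constant -/

section ConvergenceInProbability

variable {ι Ω E F G : Type*} [MeasurableSpace Ω] {P : Measure Ω} {l : Filter ι}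

/-- Convergence in measure to a constant, in terms of neighbourhoods. -/
theorem tendstoInMeasure_const_iff [PseudoEMetricSpace E] {f : ι → Ω → E} {c : E} :
    TendstoInMeasure P f l (fun _ => c) ↔
      ∀ U ∈ 𝓝 c, Tendsto (fun i => P {ω | f i ω ∉ U}) l (𝓝 0) := by
  constructor
  · intro h U hU
    obtain ⟨ε, hε, hsub⟩ := EMetric.mem_nhds_iff.mp hU
    refine tendsto_of_tendsto_of_tendsto_of_le_of_le tendsto_const_nhds (h ε hε)
      (fun _ => zero_le) fun i => measure_mono fun ω hω => ?_
    by_contra hlt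
    exact hω (hsub (Metric.mem_eball.mpr (not_le.mp hlt)))
  · intro h ε hε
    refine tendsto_of_tendsto_of_tendsto_of_le_of_le tendsto_const_nhds
      (h _ (Metric.eball_mem_nhds c hε)) (fun _ => zero_le) fun i => measure_mono fun ω hω => ?_
    exact fun hlt => not_lt.mpr hω (Metric.mem_eball.mp hlt)

theorem tendstoInMeasure_of_tendsto [PseudoEMetricSpace E] {a : ι → E} {c : E}
    (h : Tendsto a l (𝓝 c)) : TendstoInMeasure P (fun i _ => a i) l (fun _ => c) := by
  rw [tendstoInMeasure_const_iff]
  intro U hU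
  refine tendsto_const_nhds.congr' ?_
  filter_upwards [h hU] with i hi
  have hi' : a i ∈ U := hi
  simp [hi']

/-- Since the limit is constant, continuity at that one point is enough. This allows ratios whose
denominators vanish elsewhere. -/
theorem _root_.MeasureTheory.TendstoInMeasure.continuousAt_comp [PseudoEMetricSpace E] [PseudoEMetricSpace F]
    {f : ι → Ω → E} {c : E} {g : E → F} (hg : ContinuousAt g c)
    (hf : TendstoInMeasure P f l (fun _ => c)) :
    TendstoInMeasure P (fun i ω => g (f i ω)) l (fun _ => g c) := by
  rw [tendstoInMeasure_const_iff] at hf ⊢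
  exact fun U hU => hf _ (hg hU)

/-- Changing a sequence on sets of vanishing measure does not affect its limit in measure. -/
theorem _root_.MeasureTheory.TendstoInMeasure.congr_off [PseudoEMetricSpace E] {f g : ι → Ω → E} {c : E}
    (hf : TendstoInMeasure P f l (fun _ => c))
    (hfg : Tendsto (fun i => P {ω | g i ω ≠ f i ω}) l (𝓝 0)) :
    TendstoInMeasure P g l (fun _ => c) := by
  rw [tendstoInMeasure_const_iff] at hf ⊢
  intro U hU
  have h := (hf U hU).add hfg
  rw [add_zero] at h
  refine tendsto_of_tendsto_of_tendsto_of_le_of_le tendsto_const_nhds h (fun _ => zero_le)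
    fun i => le_trans (measure_mono fun ω hω => ?_) (measure_union_le _ _)
  by_cases heq : g i ω = f i ω
  · left
    simpa [heq] using hω
  · right
    exact heq

theorem tendstoInMeasure_pi {κ : Type*} [Fintype κ] {f : ι → Ω → κ → ℝ} {c : κ → ℝ}
    (hf : ∀ k, TendstoInMeasure P (fun i ω => f i ω k) l (fun _ => c k)) :
    TendstoInMeasure P f l (fun _ => c) := by
  rw [tendstoInMeasure_const_iff]
  intro U hU
  rw [nhds_pi, Filter.mem_pi] at hU
  obtain ⟨I, -, t, ht, hsub⟩ := hU
  have h := tendsto_finsetSum Finset.univ fun k _ => tendstoInMeasure_const_iff.mp (hf k) _ (ht k)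
  rw [Finset.sum_const_zero] at h
  refine tendsto_of_tendsto_of_tendsto_of_le_of_le tendsto_const_nhds h (fun _ => zero_le)
    fun i => le_trans (measure_mono fun ω hω => ?_) (measure_biUnion_finset_le _ _)
  by_contra hcon
  simp only [Set.mem_iUnion, not_exists] at hcon
  refine hω (hsub fun k _ => ?_)
  by_contra hk
  exact hcon k (Finset.mem_univ k) hk

theorem _root_.MeasureTheory.TendstoInMeasure.continuousAt_comp₂ [PseudoEMetricSpace E] [PseudoEMetricSpace F]
    [PseudoEMetricSpace G] {f : ι → Ω → E} {g : ι → Ω → F} {a : E} {b : F} {φ : E × F → G}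
    (hφ : ContinuousAt φ (a, b)) (hf : TendstoInMeasure P f l (fun _ => a))
    (hg : TendstoInMeasure P g l (fun _ => b)) :
    TendstoInMeasure P (fun i ω => φ (f i ω, g i ω)) l (fun _ => φ (a, b)) := by
  refine TendstoInMeasure.continuousAt_comp hφ (f := fun i ω => (f i ω, g i ω)) ?_
  rw [tendstoInMeasure_const_iff] at hf hg ⊢
  intro U hU
  rw [nhds_prod_eq, Filter.mem_prod_iff] at hU
  obtain ⟨s, hs, t, ht, hsub⟩ := hU
  have h := (hf s hs).add (hg t ht)
  rw [add_zero] at h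
  refine tendsto_of_tendsto_of_tendsto_of_le_of_le tendsto_const_nhds h (fun _ => zero_le)
    fun i => le_trans (measure_mono fun ω hω => ?_) (measure_union_le _ _)
  by_contra hcon
  simp only [Set.mem_union, Set.mem_ofPred_eq, not_or, not_not] at hcon
  exact hω (hsub ⟨hcon.1, hcon.2⟩)

theorem _root_.MeasureTheory.TendstoInMeasure.sub_const_limit {f g : ι → Ω → ℝ} {a b : ℝ}
    (hf : TendstoInMeasure P f l (fun _ => a)) (hg : TendstoInMeasure P g l (fun _ => b)) :
    TendstoInMeasure P (fun i ω => f i ω - g i ω) l (fun _ => a - b) :=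
  TendstoInMeasure.continuousAt_comp₂ (φ := fun p : ℝ × ℝ => p.1 - p.2) (by fun_prop) hf hg

theorem _root_.MeasureTheory.TendstoInMeasure.mul_const_limit {f g : ι → Ω → ℝ} {a b : ℝ}
    (hf : TendstoInMeasure P f l (fun _ => a)) (hg : TendstoInMeasure P g l (fun _ => b)) :
    TendstoInMeasure P (fun i ω => f i ω * g i ω) l (fun _ => a * b) :=
  TendstoInMeasure.continuousAt_comp₂ (φ := fun p : ℝ × ℝ => p.1 * p.2) (by fun_prop) hf hg

/-- The limit law needs the noise negligible at scale 1/√n; multiplying by 1/√n recovers the weaker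
statement used for consistency. -/
theorem tendstoInMeasure_of_sqrt_mul {X : ℕ → Ω → ℝ}
    (h : TendstoInMeasure P (fun (n : ℕ) ω => √(n : ℝ) * X n ω) atTop (fun _ => 0)) :
    TendstoInMeasure P X atTop (fun _ => 0) := by
  have hs : Tendsto (fun n : ℕ => (√(n : ℝ))⁻¹) atTop (𝓝 0) :=
    (Real.tendsto_sqrt_atTop.comp tendsto_natCast_atTop_atTop).inv_tendsto_atTop
  have h2 := TendstoInMeasure.mul_const_limit (tendstoInMeasure_of_tendsto (P := P) hs) h
  simp only [mul_zero] at h2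
  refine h2.congr' ?_ (ae_of_all _ fun _ => rfl)
  filter_upwards [eventually_gt_atTop 0] with n hn
  refine ae_of_all _ fun ω => ?_
  have : (0 : ℝ) < √n := Real.sqrt_pos.mpr (by exact_mod_cast hn)
  change (√(n : ℝ))⁻¹ * (√(n : ℝ) * X n ω) = X n ω
  field_simp

/-- Centred variables with vanishing variances converge to zero in probability. -/
theorem tendstoInMeasure_zero_of_variance [IsProbabilityMeasure P] {X : ι → Ω → ℝ}
    (hX : ∀ᶠ i in l, MemLp (X i) 2 P ∧ ∫ ω, X i ω ∂P = 0)
    (hvar : Tendsto (fun i => Var[X i; P]) l (𝓝 0)) :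
    TendstoInMeasure P X l (fun _ => 0) := by
  rw [tendstoInMeasure_iff_norm]
  intro ε hε
  have h : Tendsto (fun i => ENNReal.ofReal (Var[X i; P] / ε ^ 2)) l (𝓝 0) := by
    simpa using ENNReal.tendsto_ofReal (hvar.div_const (ε ^ 2))
  refine tendsto_of_tendsto_of_tendsto_of_le_of_le' tendsto_const_nhds h
    (Eventually.of_forall fun _ => zero_le) ?_
  filter_upwards [hX] with i hi
  simpa [hi.2] using meas_ge_le_variance_div_sq hi.1 hε

end ConvergenceInProbability

/-! ### Weighted sums of i.i.d. variables -/

section WeightedSums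

variable {κ Ω : Type*} [Fintype κ] [MeasurableSpace Ω] {P : Measure Ω}
  {ν : Measure ℝ} [IsProbabilityMeasure ν] {f : ℝ → ℝ} {e : Ω → κ → ℝ}

theorem memLp_weighted_sum (he : HasLaw e (Measure.pi fun _ => ν) P) (hf : MemLp f 2 ν)
    (w : κ → ℝ) : MemLp (fun ω => ∑ i, w i * f (e ω i)) 2 P := by
  have h1 : MemLp (fun v : κ → ℝ => ∑ i, w i * f (v i)) 2 (Measure.pi fun _ => ν) :=
    memLp_finsetSum _ fun i _ =>
      (hf.comp_measurePreserving (measurePreserving_eval (fun _ : κ => ν) i)).const_mul (w i)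
  rw [← he.map_eq] at h1
  exact h1.comp_of_map he.aemeasurable

theorem integral_weighted_sum (he : HasLaw e (Measure.pi fun _ => ν) P) (hf : MemLp f 2 ν)
    (hf0 : ∫ t, f t ∂ν = 0) (w : κ → ℝ) : ∫ ω, ∑ i, w i * f (e ω i) ∂P = 0 := by
  have hi : ∀ i, MemLp (fun v : κ → ℝ => f (v i)) 2 (Measure.pi fun _ => ν) := fun i =>
    hf.comp_measurePreserving (measurePreserving_eval (fun _ : κ => ν) i)
  have hint : ∀ i, Integrable (fun v : κ → ℝ => f (v i)) (Measure.pi fun _ => ν) := fun i =>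
    (hi i).integrable (by norm_num)
  have h1 := he.integral_comp (f := fun v : κ → ℝ => ∑ i, w i * f (v i))
    (Finset.aestronglyMeasurable_fun_sum _ fun i _ => (hint i).aestronglyMeasurable.const_mul (w i))
  refine h1.trans ?_
  rw [integral_finsetSum _ fun i _ => (hint i).const_mul (w i)]
  refine Finset.sum_eq_zero fun i _ => ?_
  rw [integral_const_mul, integral_comp_eval (μ := fun _ : κ => ν) hf.aestronglyMeasurable, hf0,
    mul_zero]

/-- Coordinates are independent under the product measure, so variances add; the identity is then
transported along the law of `e`. -/
theorem variance_weighted_sum (he : HasLaw e (Measure.pi fun _ => ν) P) (hf : MemLp f 2 ν)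
    (w : κ → ℝ) : Var[fun ω => ∑ i, w i * f (e ω i); P] = (∑ i, w i ^ 2) * Var[f; ν] := by
  have hm : AEMeasurable (fun v : κ → ℝ => ∑ i, w i * f (v i)) (Measure.pi fun _ => ν) :=
    (memLp_weighted_sum (HasLaw.id (μ := Measure.pi fun _ : κ => ν)) hf w).aemeasurable
  have h := variance_sum_pi (μ := fun _ : κ => ν) (X := fun i t => w i * f t)
    fun i => hf.const_mul (w i)
  have h2 : (∑ i, fun ω : κ → ℝ => w i * f (ω i)) = fun v => ∑ i, w i * f (v i) := by
    ext v; simp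
  rw [h2] at h
  rw [Finset.sum_mul]
  simp only [variance_const_mul] at h
  rw [← h, ← he.map_eq, variance_map (by rwa [he.map_eq]) he.aemeasurable]
  rfl

/-- A linear combination with unit weight vector of independent standard Gaussian variables is
standard Gaussian. -/
theorem hasLaw_gaussian_weighted_sum [IsProbabilityMeasure P]
    (he : HasLaw e (Measure.pi fun _ => gaussianReal 0 1) P) {w : κ → ℝ} (hw : ∑ i, w i ^ 2 = 1) :
    HasLaw (fun ω => ∑ i, w i * e ω i) (gaussianReal 0 1) P := by
  have hid : MemLp (fun t : ℝ => t) 2 (gaussianReal 0 1) := memLp_id_gaussianReal 2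
  have hm := memLp_weighted_sum he hid w
  have hg : HasGaussianLaw (fun v : κ → ℝ => ∑ i, w i * v i)
      (Measure.pi fun _ => gaussianReal 0 1) := by
    have hi := iIndepFun_pi (μ := fun _ : κ => gaussianReal 0 1) (X := fun i t => w i * t)
      fun i => by fun_prop
    refine iIndepFun.hasGaussianLaw_fun_sum (fun i => ?_) hi
    have := (measurePreserving_eval (fun _ : κ => gaussianReal 0 1) i).hasLaw.hasGaussianLaw
    exact this.fun_smul (w i)
  refine ⟨hm.aemeasurable, ?_⟩
  have hE := integral_weighted_sum (HasLaw.id (μ := Measure.pi fun _ : κ => gaussianReal 0 1))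
    hid (by simp) w
  have hV := variance_weighted_sum (HasLaw.id (μ := Measure.pi fun _ : κ => gaussianReal 0 1))
    hid w
  -- A Gaussian law on the line is determined by its mean, here 0, and its variance, here ∑ w² = 1.
  have h := hg.map_eq_gaussianReal
  simp only [id_eq] at hE hV
  rw [hE, hV, hw] at h
  simp only [variance_fun_id_gaussianReal] at h
  have hcomp : P.map (fun ω => ∑ i, w i * e ω i) =
      (P.map e).map (fun v : κ → ℝ => ∑ i, w i * v i) := by
    rw [AEMeasurable.map_map_of_aemeasurable
      (by rw [he.map_eq]; exact hg.aemeasurable) he.aemeasurable]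
    rfl
  rw [hcomp, he.map_eq, h]
  simp

end WeightedSums

/-! ### Empirical means and variance -/

section Mean

variable {n : ℕ}

theorem mean_add (f g : Fin n → ℝ) : mean (fun i => f i + g i) = mean f + mean g := by
  simp [mean, Finset.sum_add_distrib, add_div]

theorem mean_const_mul (c : ℝ) (f : Fin n → ℝ) : mean (fun i => c * f i) = c * mean f := by
  simp [mean, ← Finset.mul_sum, mul_div_assoc]

theorem mean_const (hn : n ≠ 0) (c : ℝ) : mean (fun _ : Fin n => c) = c := by
  simp [mean, hn]

/-- The empirical variance of a data set. -/
noncomputable def empVar (x : Fin n → ℝ) : ℝ := (mean fun i => x i ^ 2) - mean x ^ 2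

theorem sum_sub_mean_sq (hn : n ≠ 0) (x : Fin n → ℝ) :
    ∑ i, (x i - mean x) ^ 2 = n * empVar x := by
  have h : ∀ i, (x i - mean x) ^ 2 = x i ^ 2 + (-(2 * mean x) * x i + mean x ^ 2) := fun i => by
    ring
  have hn' : (n : ℝ) ≠ 0 := by exact_mod_cast hn
  have hm : ∀ f : Fin n → ℝ, ∑ i, f i = n * mean f := fun f => by
    unfold mean; field_simp
  rw [hm]
  simp only [h, mean_add, mean_const_mul, mean_const hn, empVar]
  ring

end Mean

/-! ### The linear model in terms of standardised errors -/

section LinearModel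

variable {n : ℕ}

theorem designMatrix_mulVec (x : Fin n → ℝ) (β : Fin 2 → ℝ) (i : Fin n) :
    (designMatrix x).mulVec β i = β 0 + β 1 * x i := by
  simp [designMatrix, Matrix.mulVec, dotProduct, Fin.sum_univ_two, mul_comm]

/-- The errors of the linear model, scaled to unit variance. -/
noncomputable def stdErrors (x : Fin n → ℝ) (β : Fin 2 → ℝ) (σ : ℝ) (y : Fin n → ℝ) : Fin n → ℝ :=
  fun i => (y i - (designMatrix x).mulVec β i) / σ

theorem eq_add_stdErrors (x : Fin n → ℝ) (β : Fin 2 → ℝ) {σ : ℝ} (hσ : σ ≠ 0) (y : Fin n → ℝ) :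
    y = fun i => β 0 + β 1 * x i + σ * stdErrors x β σ y i := by
  ext i
  rw [stdErrors, designMatrix_mulVec]
  field_simp
  ring

theorem hasLaw_stdErrors {Ω : Type*} [MeasurableSpace Ω] {P : Measure Ω} {x : Fin n → ℝ}
    {β : Fin 2 → ℝ} {σ : ℝ} (hσ : 0 < σ) {Y : Ω → Fin n → ℝ}
    (hY : HasLaw Y (responseLaw x β σ) P) :
    HasLaw (fun ω => stdErrors x β σ (Y ω)) (Measure.pi fun _ => gaussianReal 0 1) P := by
  have h : ∀ i, MeasurePreserving (fun t => (t - (designMatrix x).mulVec β i) / σ)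
      (gaussianReal ((designMatrix x).mulVec β i) (σ ^ 2).toNNReal) (gaussianReal 0 1) := by
    intro i
    refine ⟨by fun_prop, ?_⟩
    have h1 := gaussianReal_div_const (gaussianReal_sub_const
      (HasLaw.id (μ := gaussianReal ((designMatrix x).mulVec β i) (σ ^ 2).toNNReal))
      ((designMatrix x).mulVec β i)) σ
    have h2 := h1.map_eq
    simp only [id_eq, sub_self, zero_div] at h2
    rw [h2]
    congr 1
    ext
    simp [hσ.ne', sq_nonneg]
  exact (measurePreserving_pi _ _ h).comp_hasLaw hY

variable (x e : Fin n → ℝ) (a b σ : ℝ)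

theorem mean_response (hn : n ≠ 0) :
    mean (fun i => a + b * x i + σ * e i) = a + b * mean x + σ * mean e := by
  simp only [mean_add, mean_const_mul, mean_const hn]

theorem mean_mul_response :
    mean (fun i => x i * (a + b * x i + σ * e i)) =
      a * mean x + b * (mean fun i => x i ^ 2) + σ * mean fun i => x i * e i := by
  have h : ∀ i, x i * (a + b * x i + σ * e i) = a * x i + b * x i ^ 2 + σ * (x i * e i) := fun i => by
    ring
  simp only [h, mean_add, mean_const_mul]

/-- The lambda in the last term extends to the closing parenthesis: the term is σ² (1 + mean of (e²
- 1)). Centring the squared errors makes their average a sum that vanishes in probability. -/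
theorem mean_response_sq (hn : n ≠ 0) :
    mean (fun i => (a + b * x i + σ * e i) ^ 2) =
      a ^ 2 + 2 * a * b * mean x + b ^ 2 * (mean fun i => x i ^ 2)
        + 2 * σ * (a * mean e + b * mean fun i => x i * e i)
        + σ ^ 2 * (1 + mean fun i => e i ^ 2 - 1) := by
  have h : ∀ i, (a + b * x i + σ * e i) ^ 2 = a ^ 2 + 2 * a * b * x i + b ^ 2 * x i ^ 2
      + (2 * σ * a) * e i + (2 * σ * b) * (x i * e i) + σ ^ 2 * (1 + (e i ^ 2 - 1)) := fun i => by
    ring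
  simp only [h, mean_add, mean_const_mul, mean_const hn]
  ring

/-- The sample covariance is linear in `e`, with explicit weights; this exposes the Gaussian part of
the statistic. -/
theorem mean_mul_sub_mean_mul_mean (x e : Fin n → ℝ) :
    (mean fun i => x i * e i) - mean x * mean e = ∑ i, (x i - mean x) / n * e i := by
  have h : ∀ i, (x i - mean x) / n * e i = (x i * e i + -mean x * e i) / n := fun i => by ring
  simp only [h]
  rw [← Finset.sum_div]
  change _ = mean fun i => x i * e i + -mean x * e i
  rw [mean_add, mean_const_mul]
  ring

/-- The expected null fit is the constant β₀ + β₁ x̄, so the fitted vectors differ by β₁ (x i - x̄)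
in coordinate i. -/
theorem noncentrality_eq (hn : n ≠ 0) (β : Fin 2 → ℝ) :
    noncentrality x β σ = n * β 1 ^ 2 * empVar x / σ ^ 2 := by
  have h0 : expectedNull x β σ 0 = β 0 + β 1 * mean x := by
    have hi : ∀ i, Integrable (fun y : Fin n → ℝ => y i) (responseLaw x β σ) := fun i =>
      (measurePreserving_eval (fun i => gaussianReal ((designMatrix x).mulVec β i)
        (σ ^ 2).toNNReal) i).integrable_comp_of_integrable
        ((memLp_id_gaussianReal 1).integrable (by norm_num))
    have hE : ∀ i, ∫ y, y i ∂responseLaw x β σ = β 0 + β 1 * x i := fun i => by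
      rw [responseLaw, integral_eval, integral_id_gaussianReal, designMatrix_mulVec]
    simp only [expectedNull, Moments.betaNull, sampleMoments, Matrix.cons_val_zero]
    simp only [mean]
    rw [integral_div, integral_finsetSum _ fun i _ => hi i]
    simp only [hE]
    change mean (fun i => β 0 + β 1 * x i) = _
    rw [mean_add, mean_const_mul, mean_const hn]
    rfl
  have h1 : expectedNull x β σ 1 = 0 := by simp [expectedNull, Moments.betaNull]
  have h : ∀ i, ((designMatrix x).mulVec β i - (designMatrix x).mulVec (expectedNull x β σ) i) ^ 2
      = β 1 ^ 2 * (x i - mean x) ^ 2 := fun i => by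
    rw [designMatrix_mulVec, designMatrix_mulVec, h0, h1]
    ring
  simp only [noncentrality, h, ← Finset.mul_sum, sum_sub_mean_sq hn]
  ring

end LinearModel

/-! ### Noisy moments without truncation -/

section NoisyMoments

/-- The moments perturbed by the noise `z`, without truncation of the data. -/
noncomputable def noisyMoments {n : ℕ} (x y : Fin n → ℝ) (z : Fin 5 → ℝ) : Moments where
  xbar := mean x + z 0
  ybar := mean y + z 1
  xx := (mean fun i => x i ^ 2) + z 2
  xy := (mean fun i => x i * y i) + z 3
  yy := (mean fun i => y i ^ 2) + z 4

theorem clip_eq_self {a b t : ℝ} (h : t ∈ Set.Icc a b) : clip a b t = t := by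
  rw [clip, min_eq_right h.2, max_eq_right h.1]

theorem privateMoments_eq_noisyMoments {n : ℕ} {Δ : ℝ} {x y : Fin n → ℝ} (z : Fin 5 → ℝ)
    (hx : ∀ i, x i ∈ Set.Icc (-Δ) Δ) (hy : ∀ i, y i ∈ Set.Icc (-Δ) Δ) :
    privateMoments Δ x y z = noisyMoments x y z := by
  have hx' : ∀ i, |x i| ≤ Δ := fun i => abs_le.mpr (hx i)
  have hy' : ∀ i, |y i| ≤ Δ := fun i => abs_le.mpr (hy i)
  have h1 : ∀ i, clip (-Δ) Δ (x i) = x i := fun i => clip_eq_self (hx i)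
  have h2 : ∀ i, clip (-Δ) Δ (y i) = y i := fun i => clip_eq_self (hy i)
  have h3 : ∀ i, clip 0 (Δ ^ 2) (x i ^ 2) = x i ^ 2 := fun i =>
    clip_eq_self ⟨sq_nonneg _, sq_le_sq' (hx i).1 (hx i).2⟩
  have h4 : ∀ i, clip 0 (Δ ^ 2) (y i ^ 2) = y i ^ 2 := fun i =>
    clip_eq_self ⟨sq_nonneg _, sq_le_sq' (hy i).1 (hy i).2⟩
  have h5 : ∀ i, clip (-Δ ^ 2) (Δ ^ 2) (x i * y i) = x i * y i := fun i => by
    refine clip_eq_self (abs_le.mp ?_)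
    rw [abs_mul, sq]
    exact mul_le_mul (hx' i) (hy' i) (abs_nonneg _) ((abs_nonneg _).trans (hx' i))
  simp only [privateMoments, noisyMoments, h1, h2, h3, h4, h5]

namespace Moments

/-- Moments as a vector. -/
def toVec (s : Moments) : Fin 5 → ℝ := ![s.xbar, s.ybar, s.xx, s.xy, s.yy]

/-- Moments from a vector. -/
def ofVec (v : Fin 5 → ℝ) : Moments := ⟨v 0, v 1, v 2, v 3, v 4⟩

@[simp] theorem ofVec_toVec (s : Moments) : ofVec s.toVec = s := rfl

end Moments

/-- The limits of the moments under the linear model with intercept `a`, slope `b` and error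
variance `σ ^ 2`, when the design moments converge to `cx` and `cxx`. -/
def limitMoments (a b σ cx cxx : ℝ) : Moments where
  xbar := cx
  ybar := a + b * cx
  xx := cxx
  xy := a * cx + b * cxx
  yy := a ^ 2 + 2 * a * b * cx + b ^ 2 * cxx + σ ^ 2

end NoisyMoments

/-! ### Convergence of the noise and of the moments -/

section Convergence

variable {Ω : Type*} [MeasurableSpace Ω] {P : Measure Ω} [IsProbabilityMeasure P]

/-- Weak law for triangular arrays: the sum is centred with variance Var f · ∑ w². -/
theorem tendstoInMeasure_weighted_sum {ν : Measure ℝ} [IsProbabilityMeasure ν] {f : ℝ → ℝ}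
    (hf : MemLp f 2 ν) (hf0 : ∫ t, f t ∂ν = 0) {e : (n : ℕ) → Ω → Fin n → ℝ}
    (he : ∀ n, 2 < n → HasLaw (e n) (Measure.pi fun _ => ν) P) {w : (n : ℕ) → Fin n → ℝ}
    (hw : Tendsto (fun n => ∑ i, w n i ^ 2) atTop (𝓝 0)) :
    TendstoInMeasure P (fun n ω => ∑ i, w n i * f (e n ω i)) atTop (fun _ => 0) := by
  refine tendstoInMeasure_zero_of_variance ?_ ?_
  · filter_upwards [eventually_gt_atTop 2] with n hn
    exact ⟨memLp_weighted_sum (he n hn) hf _, integral_weighted_sum (he n hn) hf hf0 _⟩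
  · have h := hw.mul_const (Var[f; ν])
    rw [zero_mul] at h
    refine h.congr' ?_
    filter_upwards [eventually_gt_atTop 2] with n hn
    exact (variance_weighted_sum (he n hn) hf _).symm

theorem tendstoInMeasure_sqrt_mul_noise {Δ ρ : ℕ → ℝ} {N : ℕ → Ω → Fin 5 → ℝ}
    (hρ : ∀ n, 2 < n → 0 < ρ n)
    (hN : ∀ n, 2 < n → HasLaw (N n) (noiseLaw n (Δ n) (ρ n)) P)
    (hΔ2 : Tendsto (fun n => Δ n ^ 2 / (ρ n * n)) atTop (𝓝 0))
    (hΔ4 : Tendsto (fun n => Δ n ^ 4 / (ρ n * n)) atTop (𝓝 0)) (k : Fin 5) :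
    TendstoInMeasure P (fun (n : ℕ) ω => √(n : ℝ) * N n ω k) atTop (fun _ => 0) := by
  have hlaw : ∀ n, 2 < n → HasLaw (fun ω => N n ω k)
      (gaussianReal 0 (noiseVariance n (Δ n) (ρ n / 5) k).toNNReal) P := fun n hn =>
    (measurePreserving_eval (fun k => gaussianReal 0
      (noiseVariance n (Δ n) (ρ n / 5) k).toNNReal) k).comp_hasLaw (hN n hn)
  have hlim : Tendsto (fun n : ℕ => (n : ℝ) * noiseVariance n (Δ n) (ρ n / 5) k) atTop (𝓝 0) := by
    have h2 : Tendsto (fun n : ℕ => (n : ℝ) * (2 * Δ n ^ 2 / (ρ n / 5 * n ^ 2))) atTop (𝓝 0) := by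
      -- 10 = 2 · 5: the factor 2 of the variance, and the budget split among five releases.
      have := hΔ2.const_mul 10
      rw [mul_zero] at this
      refine this.congr' ?_
      filter_upwards [eventually_gt_atTop 2] with n hn
      have := hρ n hn
      field_simp
      ring
    have h4 : Tendsto (fun n : ℕ => (n : ℝ) * (2 * Δ n ^ 4 / (ρ n / 5 * n ^ 2))) atTop (𝓝 0) := by
      have := hΔ4.const_mul 10
      rw [mul_zero] at this
      refine this.congr' ?_
      filter_upwards [eventually_gt_atTop 2] with n hn
      have := hρ n hn
      field_simp
      ring
    have h4' : Tendsto (fun n : ℕ => (n : ℝ) * (Δ n ^ 4 / (2 * (ρ n / 5) * n ^ 2))) atTop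
        (𝓝 0) := by
      have := h4.const_mul (1 / 4)
      rw [mul_zero] at this
      refine this.congr' (Eventually.of_forall fun n => ?_)
      change 1 / 4 * ((n : ℝ) * (2 * Δ n ^ 4 / (ρ n / 5 * n ^ 2))) =
        n * (Δ n ^ 4 / (2 * (ρ n / 5) * n ^ 2))
      rw [show 2 * (ρ n / 5) * (n : ℝ) ^ 2 = ρ n / 5 * n ^ 2 * 2 by ring, ← div_div]
      ring
    fin_cases k
    exacts [h2, h2, h4', h4, h4']
  refine tendstoInMeasure_zero_of_variance ?_ ?_
  · filter_upwards [eventually_gt_atTop 2] with n hn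
    have hm : MemLp (fun ω => N n ω k) 2 P := by
      refine MemLp.comp_of_map (f := fun ω => N n ω k) (g := id) ?_ (hlaw n hn).aemeasurable
      rw [(hlaw n hn).map_eq]
      exact memLp_id_gaussianReal 2
    refine ⟨hm.const_mul _, ?_⟩
    rw [integral_const_mul, (hlaw n hn).integral_eq, integral_id_gaussianReal, mul_zero]
  · refine hlim.congr' ?_
    filter_upwards [eventually_gt_atTop 2] with n hn
    have := hρ n hn
    rw [variance_const_mul, (hlaw n hn).variance_eq, variance_id_gaussianReal,
      Real.sq_sqrt (Nat.cast_nonneg n), Real.coe_toNNReal]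
    -- The variances are nonnegative because ρ > 0, so `toNNReal` does not alter them.
    fin_cases k <;> simp [noiseVariance] <;> positivity

theorem tendsto_empVar {x : (n : ℕ) → Fin n → ℝ} {cx cxx : ℝ}
    (hcx : Tendsto (fun n => mean (x n)) atTop (𝓝 cx))
    (hcxx : Tendsto (fun n => mean fun i => x n i ^ 2) atTop (𝓝 cxx)) :
    Tendsto (fun n => empVar (x n)) atTop (𝓝 (cxx - cx ^ 2)) :=
  hcxx.sub (hcx.pow 2)

/-- The noisy moments converge in probability. -/
theorem tendstoInMeasure_noisyMoments {σ : ℝ} (hσ : 0 < σ) {β : ℕ → Fin 2 → ℝ} {β₀ : Fin 2 → ℝ}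
    (hβ : Tendsto β atTop (𝓝 β₀)) {x : (n : ℕ) → Fin n → ℝ}
    {Y : (n : ℕ) → Ω → Fin n → ℝ} {N : ℕ → Ω → Fin 5 → ℝ}
    (hY : ∀ n, 2 < n → HasLaw (Y n) (responseLaw (x n) (β n) σ) P)
    (hN : ∀ k, TendstoInMeasure P (fun n ω => N n ω k) atTop (fun _ => 0)) {cx cxx : ℝ}
    (hcx : Tendsto (fun n => mean (x n)) atTop (𝓝 cx))
    (hcxx : Tendsto (fun n => mean fun i => x n i ^ 2) atTop (𝓝 cxx)) :
    TendstoInMeasure P (fun n ω => (noisyMoments (x n) (Y n ω) (N n ω)).toVec) atTop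
      (fun _ => (limitMoments (β₀ 0) (β₀ 1) σ cx cxx).toVec) := by
  let e : (n : ℕ) → Ω → Fin n → ℝ := fun n ω => stdErrors (x n) (β n) σ (Y n ω)
  have he : ∀ n, 2 < n → HasLaw (e n) (Measure.pi fun _ => gaussianReal 0 1) P := fun n hn =>
    hasLaw_stdErrors hσ (hY n hn)
  have hinv : Tendsto (fun n : ℕ => ((n : ℝ))⁻¹) atTop (𝓝 0) :=
    tendsto_natCast_atTop_atTop.inv_tendsto_atTop
  have hw1 : Tendsto (fun n : ℕ => ∑ _i : Fin n, ((n : ℝ)⁻¹) ^ 2) atTop (𝓝 0) := by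
    refine hinv.congr' ?_
    filter_upwards [eventually_gt_atTop 0] with n hn
    simp
    field_simp
  have hid : MemLp (fun t : ℝ => t) 2 (gaussianReal 0 1) := memLp_id_gaussianReal 2
  have hsq : MemLp (fun t : ℝ => t ^ 2 - 1) 2 (gaussianReal 0 1) := by
    refine MemLp.sub ?_ (memLp_const 1)
    have h4 : MemLp (fun t : ℝ => t) 4 (gaussianReal 0 1) := memLp_id_gaussianReal 4
    -- By Hölder, t² is in L² because t is in L⁴.
    have : ENNReal.HolderTriple 4 4 2 := ⟨by
      rw [← two_mul, show (4 : ENNReal) = 2 * 2 by norm_num,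
        ENNReal.mul_inv (by norm_num) (by norm_num), ← mul_assoc,
        ENNReal.mul_inv_cancel (by norm_num) (by norm_num), one_mul]⟩
    simpa only [sq] using! h4.mul' h4
  have hsq0 : ∫ t, (t ^ 2 - 1) ∂gaussianReal 0 1 = 0 := by
    have h := variance_eq_integral (μ := gaussianReal 0 1) (X := fun t : ℝ => t) (by fun_prop)
    rw [variance_fun_id_gaussianReal] at h
    simp only [integral_id_gaussianReal, sub_zero] at h
    rw [integral_sub (hid.integrable_sq) (integrable_const _), ← h]
    simp
  have hA : TendstoInMeasure P (fun n ω => mean (e n ω)) atTop (fun _ => 0) := by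
    have h := tendstoInMeasure_weighted_sum hid (by simp) he hw1
    refine h.congr_left fun n => ae_of_all _ fun ω => ?_
    simp only [mean, ← Finset.mul_sum]
    ring
  have hD : TendstoInMeasure P (fun n ω => mean fun i => e n ω i ^ 2 - 1) atTop (fun _ => 0) := by
    have h := tendstoInMeasure_weighted_sum hsq hsq0 he hw1
    refine h.congr_left fun n => ae_of_all _ fun ω => ?_
    simp only [mean, ← Finset.mul_sum]
    ring
  have hB : TendstoInMeasure P (fun n ω => mean fun i => x n i * e n ω i) atTop (fun _ => 0) := by
    -- The sum of squared weights is (mean of x²) / n, and the mean of x² converges.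
    have hw2 : Tendsto (fun n : ℕ => ∑ i : Fin n, (x n i / n) ^ 2) atTop (𝓝 0) := by
      have h := hcxx.mul hinv
      rw [mul_zero] at h
      refine h.congr fun n => ?_
      simp only [mean, div_pow, ← Finset.sum_div]
      ring
    have h := tendstoInMeasure_weighted_sum hid (by simp) he hw2
    refine h.congr_left fun n => ae_of_all _ fun ω => ?_
    simp only [mean, div_mul_eq_mul_div, ← Finset.sum_div]
  have hx1 := tendstoInMeasure_of_tendsto (P := P) hcx
  have hx2 := tendstoInMeasure_of_tendsto (P := P) hcxx
  have ha := tendstoInMeasure_of_tendsto (P := P) (tendsto_pi_nhds.mp hβ 0)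
  have hb := tendstoInMeasure_of_tendsto (P := P) (tendsto_pi_nhds.mp hβ 1)
  -- All varying ingredients form one vector with a constant limit, and the moments are the
  -- polynomial map `g` of it.
  let W : ℕ → Ω → Fin 12 → ℝ := fun n ω =>
    ![mean (x n), mean fun i => x n i ^ 2, β n 0, β n 1, mean (e n ω),
      mean fun i => x n i * e n ω i, mean fun i => e n ω i ^ 2 - 1,
      N n ω 0, N n ω 1, N n ω 2, N n ω 3, N n ω 4]
  have hW : TendstoInMeasure P W atTop
      (fun _ => ![cx, cxx, β₀ 0, β₀ 1, 0, 0, 0, 0, 0, 0, 0, 0]) := by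
    refine tendstoInMeasure_pi fun k => ?_
    fin_cases k
    exacts [hx1, hx2, ha, hb, hA, hB, hD, hN 0, hN 1, hN 2, hN 3, hN 4]
  let g : (Fin 12 → ℝ) → Fin 5 → ℝ := fun w =>
    ![w 0 + w 7, w 2 + w 3 * w 0 + σ * w 4 + w 8, w 1 + w 9,
      w 2 * w 0 + w 3 * w 1 + σ * w 5 + w 10,
      w 2 ^ 2 + 2 * w 2 * w 3 * w 0 + w 3 ^ 2 * w 1 + 2 * σ * (w 2 * w 4 + w 3 * w 5)
        + σ ^ 2 * (1 + w 6) + w 11]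
  have hg : Continuous g := by
    refine continuous_pi fun k => ?_
    fin_cases k <;> simp only [g] <;> fun_prop
  have h := TendstoInMeasure.continuousAt_comp hg.continuousAt hW
  have hlim : g ![cx, cxx, β₀ 0, β₀ 1, 0, 0, 0, 0, 0, 0, 0, 0] =
      (limitMoments (β₀ 0) (β₀ 1) σ cx cxx).toVec := by
    ext k
    fin_cases k <;> simp [g, limitMoments, Moments.toVec]
  rw [hlim] at h
  refine h.congr' ?_ (ae_of_all _ fun _ => rfl)
  filter_upwards [eventually_gt_atTop 0] with n hn
  refine ae_of_all _ fun ω => ?_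
  have hy := eq_add_stdErrors (x n) (β n) hσ.ne' (Y n ω)
  change g (W n ω) = (noisyMoments (x n) (Y n ω) (N n ω)).toVec
  simp only [W, e]
  generalize stdErrors (x n) (β n) σ (Y n ω) = u at hy ⊢
  rw [hy]
  simp only [noisyMoments, Moments.toVec, mean_response _ _ _ _ _ hn.ne', mean_mul_response,
    mean_response_sq _ _ _ _ _ hn.ne']
  rfl

end Convergence

/-! ### Estimators and success near the limiting moments -/

section LimitMoments

namespace Moments

/-- The residual variance estimate without the degrees of freedom correction. -/
noncomputable def meanSqResid (s : Moments) : ℝ :=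
  s.yy - 2 * s.intercept * s.ybar - 2 * s.slope * s.xy + s.intercept ^ 2
    + 2 * s.slope * s.intercept * s.xbar + s.slope ^ 2 * s.xx

theorem residVar_eq (n r : ℕ) (s : Moments) :
    s.residVar n r = n / ((n : ℝ) - r) * s.meanSqResid := by
  rw [residVar, meanSqResid]
  ring

/-- For n > 2 the factors n, n - 1 and n - 2 are positive and can be dropped, leaving conditions
free of n. -/
theorem succeeds_of_pos {n : ℕ} (hn : 2 < n) {s : Moments}
    (h1 : 0 < s.yy - 2 * s.intercept * s.ybar + s.intercept ^ 2) (h2 : 0 < s.xx - s.xbar ^ 2) :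
    s.Succeeds n 2 := by
  have hn2 : (2 : ℝ) < n := by exact_mod_cast hn
  have h3 : (0 : ℝ) < n - (2 : ℕ) := by
    push_cast
    linarith
  have h4 : (0 : ℝ) < n - 1 := by linarith
  have h5 : (0 : ℝ) < n := by linarith
  refine lt_min ?_ ?_
  · rw [nullVar, show n * s.yy - 2 * s.intercept * n * s.ybar + n * s.intercept ^ 2 =
      n * (s.yy - 2 * s.intercept * s.ybar + s.intercept ^ 2) by ring]
    positivity
  · rw [← mul_sub]
    positivity

/-- This form separates the factor with a random limit from the one converging to a constant. -/
theorem fStat_eq_sq_mul {n : ℕ} {s : Moments} (hs : s.Succeeds n 2)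
    (hv : s.xx - s.xbar ^ 2 ≠ 0) :
    s.fStat n 2 1 = (√(n : ℝ) * (s.xy - s.xbar * s.ybar)) ^ 2 *
      ((s.xx - s.xbar ^ 2) * s.residVar n 2)⁻¹ := by
  rw [fStat_eq_of_succeeds hs, slope, mul_pow, Real.sq_sqrt (Nat.cast_nonneg n), mul_inv]
  field_simp

end Moments

variable {a b σ cx cxx : ℝ}

theorem slope_limitMoments (hv : cx ^ 2 < cxx) : (limitMoments a b σ cx cxx).slope = b := by
  have : cxx - cx ^ 2 ≠ 0 := (sub_pos.mpr hv).ne'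
  simp only [limitMoments, Moments.slope]
  field_simp
  ring

theorem intercept_limitMoments (hv : cx ^ 2 < cxx) :
    (limitMoments a b σ cx cxx).intercept = a := by
  have : cxx - cx ^ 2 ≠ 0 := (sub_pos.mpr hv).ne'
  simp only [limitMoments, Moments.intercept]
  field_simp
  ring

theorem meanSqResid_limitMoments (hv : cx ^ 2 < cxx) :
    (limitMoments a b σ cx cxx).meanSqResid = σ ^ 2 := by
  rw [Moments.meanSqResid, slope_limitMoments hv, intercept_limitMoments hv]
  simp only [limitMoments]
  ring

theorem continuousAt_slope {s : Moments} (hv : s.xx - s.xbar ^ 2 ≠ 0) :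
    ContinuousAt (fun v => (Moments.ofVec v).slope) s.toVec := by
  have h : s.toVec 2 - s.toVec 0 ^ 2 ≠ 0 := hv
  simp only [Moments.slope, Moments.ofVec]
  fun_prop (disch := assumption)

theorem continuousAt_intercept {s : Moments} (hv : s.xx - s.xbar ^ 2 ≠ 0) :
    ContinuousAt (fun v => (Moments.ofVec v).intercept) s.toVec := by
  have h : s.toVec 2 - s.toVec 0 ^ 2 ≠ 0 := hv
  simp only [Moments.intercept, Moments.ofVec]
  fun_prop (disch := assumption)

theorem continuousAt_meanSqResid {s : Moments} (hv : s.xx - s.xbar ^ 2 ≠ 0) :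
    ContinuousAt (fun v => (Moments.ofVec v).meanSqResid) s.toVec := by
  have h1 := continuousAt_slope hv
  have h2 := continuousAt_intercept hv
  have hc : ∀ k, ContinuousAt (fun v : Fin 5 → ℝ => v k) s.toVec := fun k =>
    (continuous_apply k).continuousAt
  exact (((((hc 4).sub ((h2.const_mul 2).mul (hc 1))).sub ((h1.const_mul 2).mul (hc 3))).add
    (h2.pow 2)).add (((h1.const_mul 2).mul h2).mul (hc 0))).add ((h1.pow 2).mul (hc 2))

/-- At the limit the null criterion, which uses the intercept of the unconstrained fit, equals b²
cxx + σ² > 0, and the design variance is positive. Both inequalities persist nearby, on a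
neighbourhood independent of n. -/
theorem eventually_succeeds (hσ : 0 < σ) (hv : cx ^ 2 < cxx) :
    ∀ᶠ v in 𝓝 (limitMoments a b σ cx cxx).toVec,
      0 < v 2 - v 0 ^ 2 ∧ ∀ n, 2 < n → (Moments.ofVec v).Succeeds n 2 := by
  have hv' : 0 < (limitMoments a b σ cx cxx).xx - (limitMoments a b σ cx cxx).xbar ^ 2 :=
    sub_pos.mpr hv
  have hi := continuousAt_intercept hv'.ne'
  have hc : ∀ k, ContinuousAt (fun v : Fin 5 → ℝ => v k) (limitMoments a b σ cx cxx).toVec :=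
    fun k => (continuous_apply k).continuousAt
  have h1 := ((hc 4).sub ((hi.const_mul 2).mul (hc 1))).add (hi.pow 2)
  have h2 := (hc 2).sub ((hc 0).pow 2)
  have hpos : 0 < (limitMoments a b σ cx cxx).yy - 2 * (limitMoments a b σ cx cxx).intercept *
      (limitMoments a b σ cx cxx).ybar + (limitMoments a b σ cx cxx).intercept ^ 2 := by
    rw [intercept_limitMoments hv]
    simp only [limitMoments]
    have h3 : b ^ 2 * cx ^ 2 ≤ b ^ 2 * cxx := mul_le_mul_of_nonneg_left hv.le (sq_nonneg b)
    have h4 : 0 < σ ^ 2 := by positivity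
    nlinarith [sq_nonneg (b * cx)]
  filter_upwards [h1.eventually_const_lt hpos, h2.eventually_const_lt hv'] with v hv1 hv2
  exact ⟨hv2, fun n hn => Moments.succeeds_of_pos hn hv1 hv2⟩

end LimitMoments

/-! ### Slutsky argument with oscillating signs -/

section LimitLaw

variable {Ω : Type*} [MeasurableSpace Ω] {P : Measure Ω} [IsProbabilityMeasure P]

/-- In dimension one the mean vector is the number √(η²) = |η|. -/
theorem noncentralChiSq_one (η : ℝ) :
    noncentralChiSq 1 (η ^ 2) = (gaussianReal 0 1).map fun t => (|η| + t) ^ 2 := by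
  have h1 : (Measure.pi fun _ : Fin 1 => gaussianReal |η| 1).map (fun z => z 0) =
      gaussianReal |η| 1 :=
    (measurePreserving_eval (fun _ : Fin 1 => gaussianReal |η| 1) 0).map_eq
  have h2 : gaussianReal |η| 1 = (gaussianReal 0 1).map fun t => |η| + t := by
    rw [gaussianReal_map_const_add, zero_add]
  simp only [noncentralChiSq, Nat.cast_one, div_one, Real.sqrt_sq_eq_abs, Fin.sum_univ_one]
  rw [show (fun z : Fin 1 → ℝ => z 0 ^ 2) = (fun t => t ^ 2) ∘ fun z => z 0 from rfl,
    ← Measure.map_map (by fun_prop) (by fun_prop), h1, h2,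
    Measure.map_map (by fun_prop) (by fun_prop)]
  rfl

/-- If `δ n ^ 2 → η ^ 2` and `G n` is standard Gaussian, then `(a n * (δ n + G n) + B n) ^ 2 * C n`
has the limit law of `(a₀ * (|η| + G)) ^ 2 * c₀` when `B n` vanishes and `C n → c₀`. The signs of
the `δ n` need not converge. -/
theorem tendstoInDistribution_sq_perturbed {G B C : ℕ → Ω → ℝ} {a δ : ℕ → ℝ} {a₀ c₀ η : ℝ}
    (hG : ∀ n, HasLaw (G n) (gaussianReal 0 1) P) (hB : ∀ n, AEMeasurable (B n) P)
    (hC : ∀ n, AEMeasurable (C n) P) (ha : Tendsto a atTop (𝓝 a₀))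
    (hδ : Tendsto (fun n => δ n ^ 2) atTop (𝓝 (η ^ 2)))
    (hB0 : TendstoInMeasure P B atTop (fun _ => 0))
    (hC0 : TendstoInMeasure P C atTop (fun _ => c₀)) :
    TendstoInDistribution (fun n ω => (a n * (δ n + G n ω) + B n ω) ^ 2 * C n ω) atTop
      (fun t => (a₀ * (|η| + t)) ^ 2 * c₀) (fun _ => P) (gaussianReal 0 1) := by
  -- Multiplying the base of the square by the sign of δ leaves the square unchanged. It turns δ
  -- into |δ|, which converges, and by symmetry keeps G standard Gaussian.
  let s : ℕ → ℝ := fun n => if 0 ≤ δ n then 1 else -1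
  have hs : ∀ n, s n = 1 ∧ δ n = |δ n| ∨ s n = -1 ∧ δ n = -|δ n| := fun n => by
    by_cases h : 0 ≤ δ n
    · simp [s, h, abs_of_nonneg h]
    · simp [s, h, abs_of_neg (not_le.mp h)]
  have hsG : ∀ n, HasLaw (fun ω => s n * G n ω) (gaussianReal 0 1) P := fun n => by
    rcases hs n with h | h
    · simpa [h.1] using hG n
    · simpa [h.1] using! gaussianReal_neg (hG n)
  have hdist : TendstoInDistribution (fun n ω => s n * G n ω) atTop (fun t : ℝ => t)
      (fun _ => P) (gaussianReal 0 1) := by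
    -- All terms have the same law, so any index serves as reference.
    refine tendstoInDistribution_of_identDistrib 0 (fun j => ?_) ?_
    · exact ⟨(hsG 0).aemeasurable, (hsG j).aemeasurable, by rw [(hsG 0).map_eq, (hsG j).map_eq]⟩
    · exact ⟨(hsG 0).aemeasurable, by fun_prop, by rw [(hsG 0).map_eq]; exact Measure.map_id.symm⟩
  have hsB : TendstoInMeasure P (fun n ω => s n * B n ω) atTop (fun _ => 0) := by
    rw [tendstoInMeasure_iff_norm] at hB0 ⊢
    intro ε hε
    refine (hB0 ε hε).congr fun n => ?_
    rcases hs n with h | h <;> simp [h.1]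
  have hδ' : Tendsto (fun n => |δ n|) atTop (𝓝 |η|) := by
    simpa [Real.sqrt_sq_eq_abs] using hδ.sqrt
  let V : ℕ → Ω → Fin 4 → ℝ := fun n ω => ![a n, |δ n|, s n * B n ω, C n ω]
  have hV : TendstoInMeasure P V atTop (fun _ => ![a₀, |η|, 0, c₀]) := by
    refine tendstoInMeasure_pi fun k => ?_
    fin_cases k
    exacts [tendstoInMeasure_of_tendsto ha, tendstoInMeasure_of_tendsto hδ', hsB, hC0]
  have hVm : ∀ n, AEMeasurable (V n) P := fun n => by
    refine aemeasurable_pi_lambda _ fun k => ?_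
    fin_cases k
    exacts [aemeasurable_const, aemeasurable_const, (hB n).const_mul _, hC n]
  have h := hdist.continuous_comp_prodMk_of_tendstoInMeasure_const
    (g := fun p : ℝ × (Fin 4 → ℝ) => (p.2 0 * (p.2 1 + p.1) + p.2 2) ^ 2 * p.2 3)
    (by fun_prop) hV hVm
  refine h.congr (fun n => ae_of_all _ fun ω => ?_) (ae_of_all _ fun t => ?_)
  · change (a n * (|δ n| + s n * G n ω) + s n * B n ω) ^ 2 * C n ω = _
    rcases hs n with h | h
    · rw [h.1, ← h.2, one_mul, one_mul]
    · have h2 : |δ n| = -δ n := by linarith [h.2]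
      rw [h.1, h2]
      ring
  · simp

end LimitLaw

/-! ### Decomposition of the noisy covariance -/

section CrossMoment

/-- The exact covariance is β₁ v + σ times a linear form in the errors; since ∑ (x i - x̄)² = n v,
dividing the weights by √(n v) makes them a unit vector. In the noise part, the product z₀ z₁ is
absorbed by keeping the noisy ȳ as the coefficient of z₀. -/
theorem sqrt_mul_crossMoment {n : ℕ} (hn : n ≠ 0) {x : Fin n → ℝ} (hx : 0 < empVar x)
    (β : Fin 2 → ℝ) {σ : ℝ} (hσ : 0 < σ) (y : Fin n → ℝ) (z : Fin 5 → ℝ) :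
    √(n : ℝ) * ((noisyMoments x y z).xy - (noisyMoments x y z).xbar * (noisyMoments x y z).ybar) =
      σ * √(empVar x) * (√(n : ℝ) * β 1 * √(empVar x) / σ +
        ∑ i, (x i - mean x) / √(n * empVar x) * stdErrors x β σ y i) +
      (√(n : ℝ) * z 3 - mean x * (√(n : ℝ) * z 1)
        - (noisyMoments x y z).ybar * (√(n : ℝ) * z 0)) := by
  have hn0 : (0 : ℝ) < n := by positivity
  have hsn : 0 < √(n : ℝ) := Real.sqrt_pos.mpr hn0
  have hsv : 0 < √(empVar x) := Real.sqrt_pos.mpr hx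
  have hsn2 : √(n : ℝ) ^ 2 = n := Real.sq_sqrt hn0.le
  have hsv2 : √(empVar x) ^ 2 = empVar x := Real.sq_sqrt hx.le
  have hsum : ∑ i, (x i - mean x) / √(n * empVar x) * stdErrors x β σ y i =
      √(n : ℝ) / √(empVar x) * ((mean fun i => x i * stdErrors x β σ y i)
        - mean x * mean (stdErrors x β σ y)) := by
    rw [mean_mul_sub_mean_mul_mean, Finset.mul_sum]
    refine Finset.sum_congr rfl fun i _ => ?_
    rw [Real.sqrt_mul hn0.le, ← hsn2, Real.sqrt_sq hsn.le]
    field_simp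
  rw [hsum]
  have hy := eq_add_stdErrors x β hσ.ne' y
  generalize stdErrors x β σ y = e at hy ⊢
  rw [hy]
  simp only [noisyMoments, mean_response _ _ _ _ _ hn, mean_mul_response]
  have hE : (mean fun i => x i ^ 2) = √(empVar x) ^ 2 + mean x ^ 2 := by
    rw [hsv2, empVar]
    ring
  rw [hE]
  field_simp
  ring

end CrossMoment

theorem aemeasurable_noisyMoments {Ω : Type*} [MeasurableSpace Ω] {P : Measure Ω} {n : ℕ}
    (x : Fin n → ℝ) {Y : Ω → Fin n → ℝ} {N : Ω → Fin 5 → ℝ} (hY : AEMeasurable Y P)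
    (hN : AEMeasurable N P) :
    AEMeasurable (fun ω => (noisyMoments x (Y ω) (N ω)).toVec) P := by
  refine aemeasurable_pi_lambda _ fun k => ?_
  fin_cases k <;> simp [Moments.toVec, noisyMoments, mean] <;> fun_prop

theorem measurable_inv_mul_residVar (n : ℕ) :
    Measurable fun v : Fin 5 → ℝ =>
      ((v 2 - v 0 ^ 2) * (Moments.ofVec v).residVar n 2)⁻¹ := by
  simp only [Moments.residVar, Moments.slope, Moments.intercept, Moments.ofVec]
  fun_prop

/-! ### Removing truncation, and the limit of the denominator -/

section Clipping

variable {Ω : Type*} [MeasurableSpace Ω] {P : Measure Ω}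
  {x : (n : ℕ) → Fin n → ℝ} {Δ : ℕ → ℝ} {Y : (n : ℕ) → Ω → Fin n → ℝ} {N : ℕ → Ω → Fin 5 → ℝ}

theorem tendsto_measure_privateMoments_ne
    (hYclip : Tendsto (fun n => P {ω | ∃ i, Y n ω i ∉ Set.Icc (-Δ n) (Δ n)}) atTop (𝓝 0))
    (hxclip : ∀ n, 2 < n → ∀ i, x n i ∈ Set.Icc (-Δ n) (Δ n)) :
    Tendsto (fun n => P {ω | privateMoments (Δ n) (x n) (Y n ω) (N n ω) ≠
      noisyMoments (x n) (Y n ω) (N n ω)}) atTop (𝓝 0) := by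
  refine tendsto_of_tendsto_of_tendsto_of_le_of_le' tendsto_const_nhds hYclip
    (Eventually.of_forall fun _ => zero_le) ?_
  filter_upwards [eventually_gt_atTop 2] with n hn
  refine measure_mono fun ω hω => ?_
  by_contra hcon
  simp only [Set.mem_ofPred_eq, not_exists, not_not] at hcon
  exact hω (privateMoments_eq_noisyMoments _ (hxclip n hn) hcon)

theorem tendstoInMeasure_privateMoments {v₀ : Fin 5 → ℝ}
    (hne : Tendsto (fun n => P {ω | privateMoments (Δ n) (x n) (Y n ω) (N n ω) ≠
      noisyMoments (x n) (Y n ω) (N n ω)}) atTop (𝓝 0))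
    (h : TendstoInMeasure P (fun n ω => (noisyMoments (x n) (Y n ω) (N n ω)).toVec) atTop
      (fun _ => v₀)) :
    TendstoInMeasure P (fun n ω => (privateMoments (Δ n) (x n) (Y n ω) (N n ω)).toVec) atTop
      (fun _ => v₀) := by
  exact h.congr_off (tendsto_of_tendsto_of_tendsto_of_le_of_le tendsto_const_nhds hne
    (fun _ => zero_le) fun n => measure_mono fun ω hω heq => hω (congrArg Moments.toVec heq))

/-- A sequence of random variables that agrees with the private `F`-statistic whenever the
procedure succeeds agrees, up to events of vanishing probability, with the statistic computed from
the noisy moments. -/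
theorem tendsto_measure_fStat_ne {σ a b cx cxx : ℝ} (hσ : 0 < σ) (hv : cx ^ 2 < cxx)
    (hne : Tendsto (fun n => P {ω | privateMoments (Δ n) (x n) (Y n ω) (N n ω) ≠
      noisyMoments (x n) (Y n ω) (N n ω)}) atTop (𝓝 0))
    (h : TendstoInMeasure P (fun n ω => (noisyMoments (x n) (Y n ω) (N n ω)).toVec) atTop
      (fun _ => (limitMoments a b σ cx cxx).toVec)) {T : ℕ → Ω → ℝ}
    (hT : ∀ n, 2 < n → ∀ ω, (privateMoments (Δ n) (x n) (Y n ω) (N n ω)).Succeeds n 2 →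
      T n ω = (privateMoments (Δ n) (x n) (Y n ω) (N n ω)).fStat n 2 1) :
    Tendsto (fun n => P {ω | T n ω ≠
      (√(n : ℝ) * ((noisyMoments (x n) (Y n ω) (N n ω)).xy -
        (noisyMoments (x n) (Y n ω) (N n ω)).xbar * (noisyMoments (x n) (Y n ω) (N n ω)).ybar)) ^ 2
      * (((noisyMoments (x n) (Y n ω) (N n ω)).xx - (noisyMoments (x n) (Y n ω) (N n ω)).xbar ^ 2)
        * (noisyMoments (x n) (Y n ω) (N n ω)).residVar n 2)⁻¹}) atTop (𝓝 0) := by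
  have hs := tendstoInMeasure_const_iff.mp h _ (eventually_succeeds hσ hv)
  have hadd := hne.add hs
  rw [add_zero] at hadd
  refine tendsto_of_tendsto_of_tendsto_of_le_of_le' tendsto_const_nhds hadd
    (Eventually.of_forall fun _ => zero_le) ?_
  filter_upwards [eventually_gt_atTop 2] with n hn
  refine le_trans (measure_mono fun ω hω => ?_) (measure_union_le _ _)
  by_contra hcon
  simp only [Set.mem_union, Set.mem_ofPred_eq, not_or, not_not] at hcon
  obtain ⟨heq, hpos, hsucc⟩ := hcon
  have hsucc' := hsucc n hn
  rw [Moments.ofVec_toVec] at hsucc'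
  refine hω ?_
  rw [hT n hn ω (by rwa [heq]), heq]
  exact Moments.fStat_eq_sq_mul hsucc' hpos.ne'

theorem tendstoInMeasure_inv_mul_residVar {σ a b cx cxx : ℝ} (hσ : 0 < σ) (hvar : cx ^ 2 < cxx)
    {V : ℕ → Ω → Fin 5 → ℝ}
    (hV : TendstoInMeasure P V atTop (fun _ => (limitMoments a b σ cx cxx).toVec)) :
    TendstoInMeasure P
      (fun n ω => ((V n ω 2 - V n ω 0 ^ 2) * (Moments.ofVec (V n ω)).residVar n 2)⁻¹) atTop
      (fun _ => ((cxx - cx ^ 2) * σ ^ 2)⁻¹) := by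
  have hv0 : 0 < cxx - cx ^ 2 := sub_pos.mpr hvar
  -- n / (n - 2) is the inverse of 1 - 2/n.
  have hratio : Tendsto (fun n : ℕ => (n : ℝ) / (n - (2 : ℕ))) atTop (𝓝 1) := by
    have h := (tendsto_const_nhds (x := (1 : ℝ))).sub
      ((tendsto_natCast_atTop_atTop (R := ℝ)).inv_tendsto_atTop.const_mul 2)
    have h' := h.inv₀ (by norm_num)
    simp only [mul_zero, sub_zero, inv_one] at h'
    refine h'.congr' ?_
    filter_upwards [eventually_gt_atTop 2] with n hn
    have h2 : (2 : ℝ) < n := by exact_mod_cast hn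
    have h3 : (n : ℝ) - 2 ≠ 0 := by linarith
    simp only [Pi.inv_apply]
    push_cast
    field_simp
  have hcoord : ∀ k, TendstoInMeasure P (fun n ω => V n ω k) atTop
      (fun _ => (limitMoments a b σ cx cxx).toVec k) := fun k =>
    TendstoInMeasure.continuousAt_comp (g := fun v : Fin 5 → ℝ => v k)
      (continuous_apply k).continuousAt hV
  have hx : TendstoInMeasure P (fun n ω => V n ω 0) atTop (fun _ => cx) := hcoord 0
  have hxx : TendstoInMeasure P (fun n ω => V n ω 2) atTop (fun _ => cxx) := hcoord 2
  have hvn : TendstoInMeasure P (fun n ω => V n ω 2 - V n ω 0 ^ 2) atTop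
      (fun _ => cxx - cx ^ 2) := by
    simpa only [← sq] using
      TendstoInMeasure.sub_const_limit hxx (TendstoInMeasure.mul_const_limit hx hx)
  have hq : TendstoInMeasure P (fun n ω => (Moments.ofVec (V n ω)).meanSqResid) atTop
      (fun _ => σ ^ 2) := by
    have h := TendstoInMeasure.continuousAt_comp
      (continuousAt_meanSqResid (s := limitMoments a b σ cx cxx) hv0.ne') hV
    rwa [Moments.ofVec_toVec, meanSqResid_limitMoments hvar] at h
  have hR : TendstoInMeasure P (fun n ω => (Moments.ofVec (V n ω)).residVar n 2) atTop
      (fun _ => σ ^ 2) := by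
    have h := TendstoInMeasure.mul_const_limit (tendstoInMeasure_of_tendsto (P := P) hratio) hq
    rw [one_mul] at h
    simpa only [Moments.residVar_eq] using h
  exact TendstoInMeasure.continuousAt_comp (g := fun t : ℝ => t⁻¹)
    (continuousAt_inv₀ (mul_pos hv0 (pow_pos hσ 2)).ne')
    (TendstoInMeasure.mul_const_limit hvn hR)

end Clipping

/-! ### Limit law of the statistic -/

section MainTheorem

instance {n : ℕ} (x : Fin n → ℝ) (β : Fin 2 → ℝ) (σ : ℝ) :
    IsProbabilityMeasure (responseLaw x β σ) := by
  unfold responseLaw; infer_instance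

instance (n : ℕ) (Δ ρ : ℝ) : IsProbabilityMeasure (noiseLaw n Δ ρ) := by
  unfold noiseLaw; infer_instance

variable {Ω : Type*} [MeasurableSpace Ω] {P : Measure Ω} [IsProbabilityMeasure P]

/-- The limit law of a statistic that agrees with high probability with the `F`-statistic computed
from the noisy moments. -/
theorem tendstoInDistribution_of_fStat {σ : ℝ} (hσ : 0 < σ) {β : ℕ → Fin 2 → ℝ} {a b : ℝ}
    {x : (n : ℕ) → Fin n → ℝ} {Y : (n : ℕ) → Ω → Fin n → ℝ} {N : ℕ → Ω → Fin 5 → ℝ}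
    (hY : ∀ n, 2 < n → HasLaw (Y n) (responseLaw (x n) (β n) σ) P)
    (hNm : ∀ n, 2 < n → AEMeasurable (N n) P)
    (hN : ∀ k, TendstoInMeasure P (fun (n : ℕ) ω => √(n : ℝ) * N n ω k) atTop (fun _ => 0))
    {cx cxx : ℝ} (hcx : Tendsto (fun n => mean (x n)) atTop (𝓝 cx))
    (hcxx : Tendsto (fun n => mean fun i => x n i ^ 2) atTop (𝓝 cxx)) (hvar : cx ^ 2 < cxx)
    (hM : TendstoInMeasure P (fun n ω => (noisyMoments (x n) (Y n ω) (N n ω)).toVec) atTop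
      (fun _ => (limitMoments a b σ cx cxx).toVec)) {η : ℝ}
    (hη : Tendsto (fun n => noncentrality (x n) (β n) σ) atTop (𝓝 (η ^ 2)))
    {T : ℕ → Ω → ℝ} (hTm : ∀ n, AEMeasurable (T n) P)
    (hT : Tendsto (fun n => P {ω | T n ω ≠
      (√(n : ℝ) * ((noisyMoments (x n) (Y n ω) (N n ω)).xy -
        (noisyMoments (x n) (Y n ω) (N n ω)).xbar * (noisyMoments (x n) (Y n ω) (N n ω)).ybar)) ^ 2
      * (((noisyMoments (x n) (Y n ω) (N n ω)).xx - (noisyMoments (x n) (Y n ω) (N n ω)).xbar ^ 2)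
        * (noisyMoments (x n) (Y n ω) (N n ω)).residVar n 2)⁻¹}) atTop (𝓝 0)) :
    TendstoInDistribution T atTop (fun t : ℝ => t) (fun _ => P) (noncentralChiSq 1 (η ^ 2)) := by
  have hv := tendsto_empVar hcx hcxx
  have hv0 : 0 < cxx - cx ^ 2 := sub_pos.mpr hvar
  -- The Gaussian part is standard only once the empirical variance is positive, and the
  -- perturbation lemma asks for this at every index; hence the shift by n₀.
  obtain ⟨n₀, hn₀⟩ := eventually_atTop.mp
    ((eventually_gt_atTop 2).and (hv.eventually_const_lt hv0))
  have hn2 : ∀ n, 2 < n + n₀ := fun n => (hn₀ (n + n₀) (by omega)).1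
  have hpos : ∀ n, 0 < empVar (x (n + n₀)) := fun n => (hn₀ (n + n₀) (by omega)).2
  have hshift : Tendsto (fun n => n + n₀) atTop atTop := tendsto_add_atTop_nat n₀
  let V : ℕ → Ω → Fin 5 → ℝ := fun n ω => (noisyMoments (x n) (Y n ω) (N n ω)).toVec
  have hVm : ∀ n, 2 < n → AEMeasurable (V n) P := fun n hn =>
    aemeasurable_noisyMoments _ (hY n hn).aemeasurable (hNm n hn)
  let G : ℕ → Ω → ℝ := fun n ω =>
    ∑ i, (x n i - mean (x n)) / √(n * empVar (x n)) * stdErrors (x n) (β n) σ (Y n ω) i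
  let B : ℕ → Ω → ℝ := fun n ω => √(n : ℝ) * N n ω 3 - mean (x n) * (√(n : ℝ) * N n ω 1)
    - V n ω 1 * (√(n : ℝ) * N n ω 0)
  let C : ℕ → Ω → ℝ := fun n ω =>
    ((V n ω 2 - V n ω 0 ^ 2) * (Moments.ofVec (V n ω)).residVar n 2)⁻¹
  let δ : ℕ → ℝ := fun n => √(n : ℝ) * β n 1 * √(empVar (x n)) / σ
  have hG : ∀ n, HasLaw (G (n + n₀)) (gaussianReal 0 1) P := fun n => by
    refine hasLaw_gaussian_weighted_sum (hasLaw_stdErrors hσ (hY _ (hn2 n))) ?_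
    have h0 : n + n₀ ≠ 0 := by have := hn2 n; omega
    have h1 : (0 : ℝ) < ((n + n₀ : ℕ) : ℝ) := by exact_mod_cast Nat.pos_of_ne_zero h0
    have h2 : 0 < ((n + n₀ : ℕ) : ℝ) * empVar (x (n + n₀)) := mul_pos h1 (hpos n)
    simp only [div_pow, ← Finset.sum_div, sum_sub_mean_sq h0, Real.sq_sqrt h2.le]
    exact div_self h2.ne'
  have hcomp : ∀ n k, 2 < n → AEMeasurable (fun ω => N n ω k) P := fun n k hn =>
    (measurable_pi_apply k).comp_aemeasurable (hNm n hn)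
  have hBm : ∀ n, AEMeasurable (B (n + n₀)) P := fun n =>
    (((hcomp _ 3 (hn2 n)).const_mul _).sub (((hcomp _ 1 (hn2 n)).const_mul _).const_mul _)).sub
      (((measurable_pi_apply 1).comp_aemeasurable (hVm _ (hn2 n))).mul
        ((hcomp _ 0 (hn2 n)).const_mul _))
  have hCm : ∀ n, AEMeasurable (C (n + n₀)) P := fun n =>
    (measurable_inv_mul_residVar _).comp_aemeasurable (hVm _ (hn2 n))
  have hV : ∀ k, TendstoInMeasure P (fun n ω => V n ω k) atTop
      (fun _ => (limitMoments a b σ cx cxx).toVec k) := fun k =>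
    TendstoInMeasure.continuousAt_comp (g := fun v : Fin 5 → ℝ => v k)
      (continuous_apply k).continuousAt hM
  have hB0 : TendstoInMeasure P B atTop (fun _ => 0) := by
    have h1 := TendstoInMeasure.mul_const_limit (tendstoInMeasure_of_tendsto (P := P) hcx) (hN 1)
    have h2 := TendstoInMeasure.mul_const_limit (hV 1) (hN 0)
    simpa only [mul_zero, sub_zero] using
      TendstoInMeasure.sub_const_limit (TendstoInMeasure.sub_const_limit (hN 3) h1) h2
  have hC0 : TendstoInMeasure P C atTop (fun _ => ((cxx - cx ^ 2) * σ ^ 2)⁻¹) :=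
    tendstoInMeasure_inv_mul_residVar hσ hvar hM
  have hδ : Tendsto (fun n => δ n ^ 2) atTop (𝓝 (η ^ 2)) := by
    refine hη.congr' ?_
    filter_upwards [eventually_ge_atTop n₀] with n hn
    have h := hn₀ n hn
    rw [noncentrality_eq _ _ (by omega)]
    simp only [δ, div_pow, mul_pow, Real.sq_sqrt (Nat.cast_nonneg n), Real.sq_sqrt h.2.le]
  have hdist := tendstoInDistribution_sq_perturbed hG hBm hCm
    ((hv.sqrt.const_mul σ).comp hshift) (hδ.comp hshift) (hB0.comp hshift) (hC0.comp hshift)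
  have hTshift : TendstoInDistribution (fun n => T (n + n₀)) atTop
      (fun t => (σ * √(cxx - cx ^ 2) * (|η| + t)) ^ 2 * ((cxx - cx ^ 2) * σ ^ 2)⁻¹)
      (fun _ => P) (gaussianReal 0 1) := by
    -- `T` minus the explicit statistic is zero off events of vanishing probability, so it tends to
    -- 0 in probability and both share the limit law.
    refine tendstoInDistribution_of_tendstoInMeasure_sub _ _ hdist ?_ fun n => hTm _
    refine TendstoInMeasure.congr_off (f := fun _ _ => (0 : ℝ))
      (tendstoInMeasure_of_tendsto tendsto_const_nhds) ?_
    refine (hT.comp hshift).congr fun n => ?_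
    refine congrArg P (Set.ext fun ω => not_congr ?_)
    have h := sqrt_mul_crossMoment (n := n + n₀) (by have := hn2 n; omega) (hpos n)
      (β (n + n₀)) hσ (Y (n + n₀) ω) (N (n + n₀) ω)
    rw [h]
    exact sub_eq_zero.symm
  refine ⟨hTm, by fun_prop, ?_⟩
  refine (tendsto_add_atTop_iff_nat n₀).mp ?_
  convert! hTshift.tendsto using 2
  refine congrArg 𝓝 (Subtype.ext ?_)
  change (noncentralChiSq 1 (η ^ 2)).map id = _
  rw [Measure.map_id, noncentralChiSq_one]
  refine congrArg (fun f => (gaussianReal 0 1).map f) (funext fun t => ?_)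
  -- The scale (σ√(cxx - cx²))² cancels against the limiting denominator.
  rw [mul_pow, mul_pow, Real.sq_sqrt hv0.le]
  field_simp

end MainTheorem

end DPRegression

/-! ### Assembly of the three claims -/

theorem mainTheorem1
    {Ω : Type*} [MeasurableSpace Ω] (P : Measure Ω) [IsProbabilityMeasure P]
    (σ : ℝ) (hσ : 0 < σ)
    -- coefficients `![intercept, slope]`, possibly varying with the sample size
    (β : ℕ → Fin 2 → ℝ) (β₀ : Fin 2 → ℝ) (hβ : Tendsto β atTop (𝓝 β₀))
    (x : (n : ℕ) → Fin n → ℝ)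
    (Δ ρ : ℕ → ℝ) (hΔ : ∀ n, 2 < n → 0 < Δ n) (hρ : ∀ n, 2 < n → 0 < ρ n)
    -- responses and privacy noise: the noise is independent of the data
    (Y : (n : ℕ) → Ω → Fin n → ℝ) (N : ℕ → Ω → Fin 5 → ℝ)
    (hYN : ∀ n, 2 < n → HasLaw (fun ω => (Y n ω, N n ω))
      ((DPRegression.responseLaw (x n) (β n) σ).prod (DPRegression.noiseLaw n (Δ n) (ρ n))) P)
    -- design moments
    (cx cxx : ℝ)
    (hcx : Tendsto (fun n => DPRegression.mean (x n)) atTop (𝓝 cx))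
    (hcxx : Tendsto (fun n => DPRegression.mean fun i => x n i ^ 2) atTop (𝓝 cxx))
    (hvar : cx ^ 2 < cxx)
    -- privacy noise
    (hΔ2 : Tendsto (fun n => Δ n ^ 2 / (ρ n * n)) atTop (𝓝 0))
    (hΔ4 : Tendsto (fun n => Δ n ^ 4 / (ρ n * n)) atTop (𝓝 0))
    -- clipping
    (hYclip : Tendsto (fun n => P {ω | ∃ i, Y n ω i ∉ Set.Icc (-Δ n) (Δ n)}) atTop (𝓝 0))
    (hxclip : ∀ n, 2 < n → ∀ i, x n i ∈ Set.Icc (-Δ n) (Δ n)) :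
    -- consistency under the null hypothesis
    (β₀ 1 = 0 → TendstoInMeasure P
      (fun n ω => (DPRegression.privateMoments (Δ n) (x n) (Y n ω) (N n ω)).betaNull)
      atTop (fun _ => β₀)) ∧
    -- consistency under the alternative
    TendstoInMeasure P
      (fun n ω => (DPRegression.privateMoments (Δ n) (x n) (Y n ω) (N n ω)).betaAlt)
      atTop (fun _ => β₀) ∧
    -- limit law of the private statistic, whatever value it is given when the procedure fails
    (∀ η : ℝ,
      Tendsto (fun n => DPRegression.noncentrality (x n) (β n) σ) atTop (𝓝 (η ^ 2)) →
      ∀ T : ℕ → Ω → ℝ, (∀ n, AEMeasurable (T n) P) →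
      (∀ n, 2 < n → ∀ ω,
        (DPRegression.privateMoments (Δ n) (x n) (Y n ω) (N n ω)).Succeeds n 2 →
        T n ω = (DPRegression.privateMoments (Δ n) (x n) (Y n ω) (N n ω)).fStat n 2 1) →
      TendstoInDistribution T atTop (fun t : ℝ => t / ((2 : ℝ) - 1)) (fun _ => P)
        (DPRegression.noncentralChiSq (2 - 1) (η ^ 2))) := by
  have hY : ∀ n, 2 < n → HasLaw (Y n) (DPRegression.responseLaw (x n) (β n) σ) P := fun n hn =>
    measurePreserving_fst.comp_hasLaw (hYN n hn)
  have hN : ∀ n, 2 < n → HasLaw (N n) (DPRegression.noiseLaw n (Δ n) (ρ n)) P := fun n hn =>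
    measurePreserving_snd.comp_hasLaw (hYN n hn)
  have hnoise := DPRegression.tendstoInMeasure_sqrt_mul_noise hρ hN hΔ2 hΔ4
  have hM := DPRegression.tendstoInMeasure_noisyMoments hσ hβ hY
    (fun k => DPRegression.tendstoInMeasure_of_sqrt_mul (hnoise k)) hcx hcxx
  have hne := DPRegression.tendsto_measure_privateMoments_ne (N := N) hYclip hxclip
  have hPM := DPRegression.tendstoInMeasure_privateMoments hne hM
  refine ⟨fun hβ0 => ?_, ?_, fun η hη T hTm hT => ?_⟩
  · refine DPRegression.tendstoInMeasure_pi fun k => ?_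
    fin_cases k
    · have h := TendstoInMeasure.continuousAt_comp (g := fun v : Fin 5 → ℝ => v 1)
        (continuous_apply 1).continuousAt hPM
      -- The limit of ȳ is β₀ 0 + β₀ 1 · cx, which is the intercept once the slope is zero.
      simpa [DPRegression.limitMoments, DPRegression.Moments.toVec, hβ0] using! h
    · simpa [hβ0] using! DPRegression.tendstoInMeasure_of_tendsto (P := P) (l := atTop (α := ℕ))
        (tendsto_const_nhds (x := (0 : ℝ)))
  · have hv : cxx - cx ^ 2 ≠ 0 := (sub_pos.mpr hvar).ne'
    refine DPRegression.tendstoInMeasure_pi fun k => ?_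
    fin_cases k
    · have h := TendstoInMeasure.continuousAt_comp
        (DPRegression.continuousAt_intercept hv) hPM
      rwa [DPRegression.Moments.ofVec_toVec, DPRegression.intercept_limitMoments hvar] at h
    · have h := TendstoInMeasure.continuousAt_comp
        (DPRegression.continuousAt_slope hv) hPM
      rwa [DPRegression.Moments.ofVec_toVec, DPRegression.slope_limitMoments hvar] at h
  · have h := DPRegression.tendstoInDistribution_of_fStat hσ hY (fun n hn => (hN n hn).aemeasurable)
      hnoise hcx hcxx hvar hM hη hTm (DPRegression.tendsto_measure_fStat_ne hσ hvar hne hM hT)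
    refine h.congr (fun _ => ae_of_all _ fun _ => rfl) (ae_of_all _ fun t => ?_)
    change t = t / (2 - 1)
    norm_num
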